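/- All graphs are finite and simple; $d(u,v)$ is the distance and $d(G)$ the diameter. A \emph{radio labeling} of a connected graph $G$ is a map $f:V(G)\to\{0,1,2,\dots\}$ with $|f(u)-f(v)|\ge d(G)+1-d(u,v)$ for all distinct vertices $u,v$; the \emph{radio number} $rn(G)$ is the minimum of $\max_{u,v}|f(u)-f(v)|$ over all radio labelings $f$. A \emph{block} is a maximal connected induced subgraph without cut-vertices (of that subgraph), and a \emph{block graph} is a connected graph all of whose blocks are complete. Let $W(G)$ be the set of vertices $v$ that minimize $\sum_{u}d(u,v)$; put $\varepsilon(G)=1$ if $|W(G)|=1$ and $\varepsilon(G)=0$ otherwise. A \emph{central vertex} of a block graph $G$ is the vertex of $W(G)$ if $|W(G)|=1$, and a vertex of the block that contains $W(G)$ if $|W(G)|\ge 2$. The \emph{level} of a vertex is its distance to the nearest central vertex, and $L(G)$ is the sum of all levels. A block graph $G$ of order $p$ and diameter $d(G)\ge 2$ is a \emph{lower bound block graph} if $rn(G)=(p-1)(d(G)+\varepsilon(G))-2L(G)+\varepsilon(G)$. Let $r,m\ge 1$ be integers with $m\ne 2$, and let $(k_i,m_i)$, $1\le i\le r$, be pairs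 of integers with $k_i\ge 1$ and $m_i\ge 2$; if $m=1$, assume moreover $k_1\ge 2$. The \emph{level-wise regular block graph} $G=G^m_{(k_1,m_1)(k_2,m_2)\cdots(k_r,m_r)}$ is constructed as follows. Start with a clique on $m$ vertices $w^0,\dots,w^{m-1}$. At step $1$, identify one vertex of each of $k_1$ copies of $K_{m_1+1}$ with each of $w^0,\dots,w^{m-1}$. At step $i$, $2\le i\le r$, identify one vertex of each of $k_i$ copies of $K_{m_i+1}$ with each non-cut-vertex of the cliques joined at step $i-1$ (that is, with each vertex that was new at step $i-1$). Then $G$ is a lower bound block graph, and $$ rn(G)=\Bigl[(m-1)+m\sum_{i=1}^{r}\ \prod_{1\le j\le i}k_jm_j\Bigr](2r+1)-2m\sum_{i=1}^{r} i\prod_{1\le j\le i}k_jm_j+\varepsilon(G). $$ -/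

import Mathlib

/-! ### Radio labelings of finite graphs -/

/-- A radio labeling: `|f u - f v| ≥ d(G) + 1 - d(u,v)` for every pair of distinct vertices. -/
def IsRadioLabeling {V : Type*} (G : SimpleGraph V) (f : V → ℕ) : Prop :=
  ∀ u v : V, u ≠ v → (G.diam : ℤ) + 1 - (G.dist u v : ℤ) ≤ |(f u : ℤ) - (f v : ℤ)|

/-- The span of a labeling: the largest difference of two labels. -/
def labelingSpan {V : Type*} [Fintype V] (f : V → ℕ) : ℕ :=
  Finset.univ.sup fun p : V × V => ((f p.1 : ℤ) - (f p.2 : ℤ)).natAbs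

/-- The radio number: the smallest span of a radio labeling. -/
noncomputable def radioNumber {V : Type*} [Fintype V] (G : SimpleGraph V) : ℕ :=
  sInf {t : ℕ | ∃ f : V → ℕ, IsRadioLabeling G f ∧ labelingSpan f = t}

/-! ### Blocks and block graphs -/

/-- A cut-vertex: its deletion increases the number of connected components. -/
def IsCutVertex {V : Type*} (G : SimpleGraph V) (v : V) : Prop :=
  Nat.card G.ConnectedComponent < Nat.card (G.induce {v}ᶜ).ConnectedComponent

/-- A set of vertices that induces a connected subgraph without cut-vertices. -/
def InducesTwoConnected {V : Type*} (G : SimpleGraph V) (S : Set V) : Prop :=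
  (G.induce S).Connected ∧ ∀ v : S, ¬ IsCutVertex (G.induce S) v

/-- A block (given by its vertex set): a maximal induced connected subgraph without
cut-vertices. -/
def IsBlock {V : Type*} (G : SimpleGraph V) (B : Set V) : Prop :=
  Maximal (InducesTwoConnected G) B

/-- A block graph: a connected graph all of whose blocks are cliques. -/
def IsBlockGraph {V : Type*} (G : SimpleGraph V) : Prop :=
  G.Connected ∧ ∀ B : Set V, IsBlock G B → G.IsClique B

/-! ### Weight centers, levels and the lower bound -/

/-- The weight of `G` at `v`: the sum of the distances to `v`. -/
noncomputable def weightAt {V : Type*} [Fintype V] (G : SimpleGraph V) (v : V) : ℕ :=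
  ∑ u : V, G.dist u v

/-- The weight of `G`: the minimum of the weights at its vertices. -/
noncomputable def graphWeight {V : Type*} [Fintype V] (G : SimpleGraph V) : ℕ :=
  ⨅ v : V, weightAt G v

/-- The set `W(G)` of weight centers. -/
def weightCenters {V : Type*} [Fintype V] (G : SimpleGraph V) : Set V :=
  {v | weightAt G v = graphWeight G}

/-- A central vertex: the only weight center, or, if there are at least two weight centers,
a vertex of the central block, that is, of the block that contains all weight centers. -/
def IsCentralVertex {V : Type*} [Fintype V] (G : SimpleGraph V) (v : V) : Prop :=
  weightCenters G = {v} ∨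
    (2 ≤ (weightCenters G).ncard ∧
      ∃ B : Set V, IsBlock G B ∧ weightCenters G ⊆ B ∧ v ∈ B)

/-- The level of a vertex: its distance to the nearest central vertex. -/
noncomputable def vertexLevel {V : Type*} [Fintype V] (G : SimpleGraph V) (v : V) : ℕ :=
  sInf {l : ℕ | ∃ w : V, IsCentralVertex G w ∧ G.dist v w = l}

/-- The total level `L(G)`. -/
noncomputable def totalLevel {V : Type*} [Fintype V] (G : SimpleGraph V) : ℕ :=
  ∑ v : V, vertexLevel G v

/-- `ε(G)` is `1` if there is exactly one weight center, and `0` if there are more. -/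
noncomputable def centerEps {V : Type*} [Fintype V] (G : SimpleGraph V) : ℕ :=
  if (weightCenters G).ncard = 1 then 1 else 0

/-- The bound `LB(G) = (p - 1) (d(G) + ε(G)) - 2 L(G) + ε(G)`, where `p` is the order. -/
noncomputable def radioLowerBound {V : Type*} [Fintype V] (G : SimpleGraph V) : ℤ :=
  ((Fintype.card V : ℤ) - 1) * ((G.diam : ℤ) + (centerEps G : ℤ))
    - 2 * (totalLevel G : ℤ) + (centerEps G : ℤ)

/-- A lower bound block graph: a block graph (of diameter at least two, which is where the
bound `LB` is considered) whose radio number equals `LB(G)`. -/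
def IsLowerBoundBlockGraph {V : Type*} [Fintype V] (G : SimpleGraph V) : Prop :=
  IsBlockGraph G ∧ 2 ≤ G.diam ∧ (radioNumber G : ℤ) = radioLowerBound G

/-! ### Level-wise regular block graphs

The parameters are `m` and the pairs `(k i, n i)` for `1 ≤ i ≤ r`; values of `k` and `n` at other
indices play no role. -/

/-- The vertices that are new at step `i`. At step `0` these are `w^0, …, w^(m-1)`. At step `i + 1`
every vertex `v` that was new at step `i` gets `k (i+1)` cliques on `n (i+1) + 1` vertices, one
vertex of each being identified with `v`; the vertex `(v, c, a)` is the `a`-th of the `n (i+1)`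
other vertices of the `c`-th clique at `v`. -/
def LevelVertex (m : ℕ) (k n : ℕ → ℕ) : ℕ → Type
  | 0 => Fin m
  | i + 1 => LevelVertex m k n i × Fin (k (i + 1)) × Fin (n (i + 1))

/-- There are finitely many new vertices at each step. -/
instance instFintypeLevelVertex (m : ℕ) (k n : ℕ → ℕ) : ∀ i : ℕ, Fintype (LevelVertex m k n i)
  | 0 => inferInstanceAs (Fintype (Fin m))
  | i + 1 =>
    haveI := instFintypeLevelVertex m k n i
    inferInstanceAs (Fintype (LevelVertex m k n i × Fin (k (i + 1)) × Fin (n (i + 1))))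

/-- All vertices after `r` steps. -/
abbrev LevelwiseVertex (m r : ℕ) (k n : ℕ → ℕ) : Type :=
  Σ i : Fin (r + 1), LevelVertex m k n i.val

/-- The vertex set of the initial clique. -/
def initialClique (m r : ℕ) (k n : ℕ → ℕ) : Set (LevelwiseVertex m r k n) :=
  Set.range fun w : Fin m => ⟨0, w⟩

/-- The vertex set of the `c`-th clique that step `i + 1` joins to the vertex `v`: it consists of
`v` and of the `n (i+1)` new vertices `(v, c, a)`. -/
def joinedClique (m r : ℕ) (k n : ℕ → ℕ) (i : Fin r) (v : LevelVertex m k n i.val)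
    (c : Fin (k (i.val + 1))) : Set (LevelwiseVertex m r k n) :=
  insert ⟨i.castSucc, v⟩ (Set.range fun a : Fin (n (i.val + 1)) => ⟨i.succ, (v, c, a)⟩)

/-- The level-wise regular block graph: two distinct vertices are adjacent if and only if
they lie together in the initial clique or in one of the joined cliques. -/
def levelwiseGraph (m r : ℕ) (k n : ℕ → ℕ) : SimpleGraph (LevelwiseVertex m r k n) where
  Adj x y := x ≠ y ∧
    ((x ∈ initialClique m r k n ∧ y ∈ initialClique m r k n) ∨
      ∃ (i : Fin r) (v : LevelVertex m k n i.val) (c : Fin (k (i.val + 1))),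
        x ∈ joinedClique m r k n i v c ∧ y ∈ joinedClique m r k n i v c)
  symm := ⟨fun _ _ h => ⟨h.1.symm, h.2.imp And.symm fun ⟨i, v, c, h⟩ => ⟨i, v, c, h.symm⟩⟩⟩
  loopless := ⟨fun _ h => h.1 rfl⟩

/-! Write `N i = levelCount m k n i`. Vertices of depth `i` are coded by the numbers below `N i` in
a mixed radix in which reduction modulo `N h` gives the ancestor of depth `h`. Ancestry and
adjacency become congruences, and counting upwards spreads consecutive vertices over different trees
or branches.

A branch off the initial clique holds less than half of the vertices, so all weight centers lie in
that clique; by symmetry they are all of it. Levels are therefore depths. The diameter is `2 * r`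
for `m = 1`, where ε is 1, and `2 * r + 1` for `m ≥ 3`, where ε is 0; in both cases the sum of
diameter and ε is `2 * r + 1`.

Lower bound: `dist x y ≤ depth x + depth y + crossLength m`, so consecutive labels differ by at
least `2 * r + 1` minus the two depths. Summation counts every depth twice except at the two ends,
whose depths add up to at least ε because for `m = 1` only one vertex has depth 0.

Upper bound: list the vertices by increasing depth, with code congruent to the position `s` modulo
`N` of the depth, move position 0 to the very end, and make every gap of consecutive labels exactly
`2 * r + 1` minus the two depths (`seqLabel`). The end depths then add up to ε. For positions `e +
1` apart the labels gain at least `e` further units, so the distance may fall short of its upper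
bound by `e`. If the last common ancestor has depth `h`, the shortfall is at most `2 * h + 1 +
crossLength m`, while the positions agree modulo `N h`, so `e + 1 ≥ N h`. Since `N` at least doubles
at each step, this suffices (`depth_add_depth_le_dist_add`); only consecutive positions for `m = 1`
need the separate remark that they lie in different branches. -/

/-! ### Codes of the vertices -/

/-- The number of vertices that are new at step `i`. -/
def levelCount (m : ℕ) (k n : ℕ → ℕ) : ℕ → ℕ
  | 0 => m
  | i + 1 => levelCount m k n i * (k (i + 1) * n (i + 1))

/-- A number below `levelCount m k n i` that determines a vertex that is new at step `i`; the code
of the ancestor that is new at step `h` is the residue modulo `levelCount m k n h`. -/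
def levelCode (m : ℕ) (k n : ℕ → ℕ) : ∀ i : ℕ, LevelVertex m k n i → ℕ
  | 0, v => Fin.val (n := m) v
  | i + 1, v => levelCode m k n i v.1 + levelCount m k n i * (v.2.1.val + k (i + 1) * v.2.2.val)

theorem levelCount_eq_prod (m : ℕ) (k n : ℕ → ℕ) (i : ℕ) :
    levelCount m k n i = m * ∏ j ∈ Finset.Icc 1 i, k j * n j := by
  induction i with
  | zero => simp [levelCount]
  | succ i ih => rw [levelCount, ih, Finset.prod_Icc_succ_top (by omega), mul_assoc]

theorem levelCount_dvd (m : ℕ) (k n : ℕ → ℕ) {h i : ℕ} (hi : h ≤ i) :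
    levelCount m k n h ∣ levelCount m k n i := by
  induction i, hi using Nat.le_induction with
  | base => rfl
  | succ i _ ih => exact ih.trans (Dvd.intro _ rfl)

theorem levelCount_mul_dvd (m : ℕ) (k n : ℕ → ℕ) {h i : ℕ} (hi : h < i) :
    levelCount m k n h * k (h + 1) ∣ levelCount m k n i := by
  refine Dvd.dvd.trans ?_ (levelCount_dvd m k n (Nat.succ_le_of_lt hi))
  rw [levelCount, ← mul_assoc]
  exact Dvd.intro _ rfl

theorem levelCode_lt (m : ℕ) (k n : ℕ → ℕ) (i : ℕ) (v : LevelVertex m k n i) :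
    levelCode m k n i v < levelCount m k n i := by
  induction i with
  | zero => exact Fin.isLt (n := m) v
  | succ i ih =>
    obtain ⟨v, c, a⟩ := v
    have h1 := ih v
    have h2 : c.val + k (i + 1) * a.val + 1 ≤ k (i + 1) * n (i + 1) := by
      have := c.isLt
      have := Nat.mul_le_mul_left (k (i + 1)) (Nat.succ_le_of_lt a.isLt)
      rw [Nat.mul_succ] at this
      omega
    have h3 := Nat.mul_le_mul_left (levelCount m k n i) h2
    simp only [levelCode, levelCount]
    rw [Nat.mul_succ] at h3
    omega

theorem levelCode_succ_mod (m : ℕ) (k n : ℕ → ℕ) (i : ℕ) (v : LevelVertex m k n i)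
    (c : Fin (k (i + 1))) (a : Fin (n (i + 1))) :
    levelCode m k n (i + 1) (v, c, a) % levelCount m k n i = levelCode m k n i v := by
  simp only [levelCode]
  rw [Nat.add_mul_mod_self_left, Nat.mod_eq_of_lt (levelCode_lt m k n i v)]

/-- The digit `c` is less significant than `a`, so this residue remembers the joined clique and
forgets only the place in it. -/
theorem levelCode_succ_mod_mul (m : ℕ) (k n : ℕ → ℕ) (i : ℕ) (v : LevelVertex m k n i)
    (c : Fin (k (i + 1))) (a : Fin (n (i + 1))) :
    levelCode m k n (i + 1) (v, c, a) % (levelCount m k n i * k (i + 1)) =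
      levelCode m k n i v + levelCount m k n i * c.val := by
  have h1 := levelCode_lt m k n i v
  have h2 := Nat.mul_le_mul_left (levelCount m k n i) (Nat.succ_le_of_lt c.isLt)
  rw [Nat.mul_succ] at h2
  simp only [levelCode]
  rw [mul_add, ← add_assoc, ← mul_assoc, Nat.add_mul_mod_self_left, Nat.mod_eq_of_lt (by omega)]

theorem levelCode_injective (m : ℕ) (k n : ℕ → ℕ) (i : ℕ) :
    Function.Injective (levelCode m k n i) := by
  induction i with
  | zero => exact Fin.val_injective (n := m)
  | succ i ih =>
    rintro ⟨v, c, a⟩ ⟨v', c', a'⟩ h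
    have h1 := levelCode_succ_mod m k n i v c a
    rw [h, levelCode_succ_mod] at h1
    obtain rfl := ih h1
    have hN := (Nat.zero_le _).trans_lt (levelCode_lt m k n i v')
    have h2 := levelCode_succ_mod_mul m k n i v' c a
    rw [h, levelCode_succ_mod_mul] at h2
    have hc : c' = c := Fin.ext (Nat.eq_of_mul_eq_mul_left hN (by omega))
    subst hc
    have hk := (Nat.zero_le _).trans_lt c'.isLt
    simp only [levelCode] at h
    have h3 := Nat.eq_of_mul_eq_mul_left hN (Nat.add_left_cancel h)
    have ha : a = a' := Fin.ext (Nat.eq_of_mul_eq_mul_left hk (by omega))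
    rw [ha]

theorem exists_levelCode_eq (m : ℕ) (k n : ℕ → ℕ) (i : ℕ) {q : ℕ} (hq : q < levelCount m k n i) :
    ∃ v, levelCode m k n i v = q := by
  induction i generalizing q with
  | zero => exact ⟨(⟨q, hq⟩ : Fin m), rfl⟩
  | succ i ih =>
    have hpos : 0 < levelCount m k n i * (k (i + 1) * n (i + 1)) := (Nat.zero_le _).trans_lt hq
    have hN : 0 < levelCount m k n i := Nat.pos_of_mul_pos_right hpos
    have hkn : 0 < k (i + 1) * n (i + 1) := Nat.pos_of_mul_pos_left hpos
    have hk : 0 < k (i + 1) := Nat.pos_of_mul_pos_right hkn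
    obtain ⟨v, hv⟩ := ih (Nat.mod_lt q hN)
    have h1 : q / levelCount m k n i < k (i + 1) * n (i + 1) := Nat.div_lt_of_lt_mul hq
    refine ⟨(v, ⟨_, Nat.mod_lt (q / levelCount m k n i) hk⟩,
      ⟨q / levelCount m k n i / k (i + 1), Nat.div_lt_of_lt_mul h1⟩), ?_⟩
    simp only [levelCode, hv, Nat.mod_add_div]

variable {m r : ℕ} {k n : ℕ → ℕ}

/-- The step at which a vertex is new. -/
def depth (x : LevelwiseVertex m r k n) : ℕ := x.1.val

/-- The code of a vertex among those that are new at the same step. -/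
def code (x : LevelwiseVertex m r k n) : ℕ := levelCode m k n x.1.val x.2

theorem depth_le (x : LevelwiseVertex m r k n) : depth x ≤ r := Nat.lt_succ_iff.mp x.1.isLt

theorem code_lt (x : LevelwiseVertex m r k n) : code x < levelCount m k n (depth x) :=
  levelCode_lt m k n _ x.2

theorem eq_of_depth_code {x y : LevelwiseVertex m r k n} (hd : depth x = depth y)
    (hc : code x = code y) : x = y := by
  obtain ⟨i, v⟩ := x
  obtain ⟨j, w⟩ := y
  obtain rfl : i = j := Fin.ext hd
  exact congrArg (Sigma.mk i) (levelCode_injective m k n i.val hc)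

theorem eq_of_depth_code_modEq {x y : LevelwiseVertex m r k n} (hd : depth x = depth y)
    (hc : code x ≡ code y [MOD levelCount m k n (depth x)]) : x = y :=
  eq_of_depth_code hd (hc.eq_of_lt_of_lt (code_lt x) (hd ▸ code_lt y))

theorem exists_depth_code {i q : ℕ} (hi : i ≤ r) (hq : q < levelCount m k n i) :
    ∃ x : LevelwiseVertex m r k n, depth x = i ∧ code x = q := by
  obtain ⟨v, hv⟩ := exists_levelCode_eq m k n i hq
  exact ⟨⟨⟨i, Nat.lt_succ_of_le hi⟩, v⟩, rfl, hv⟩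

theorem mem_initialClique_iff {x : LevelwiseVertex m r k n} :
    x ∈ initialClique m r k n ↔ depth x = 0 := by
  constructor
  · rintro ⟨w, rfl⟩
    rfl
  · obtain ⟨i, v⟩ := x
    intro h
    obtain rfl : i = 0 := Fin.ext h
    exact ⟨v, rfl⟩

theorem exists_eq_succ {x : LevelwiseVertex m r k n} (hx : depth x ≠ 0) :
    ∃ (i : Fin r) (v : LevelVertex m k n i.val) (c : Fin (k (i.val + 1)))
      (a : Fin (n (i.val + 1))), x = ⟨i.succ, (v, c, a)⟩ := by
  obtain ⟨i, v⟩ := x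
  induction i using Fin.cases with
  | zero => exact absurd rfl hx
  | succ i => exact ⟨i, v.1, v.2.1, v.2.2, rfl⟩

/-- The parent of a vertex that is not in the initial clique. -/
theorem exists_parent {x : LevelwiseVertex m r k n} (hx : depth x ≠ 0) :
    ∃ y, (levelwiseGraph m r k n).Adj x y ∧ depth x = depth y + 1 ∧
      code x ≡ code y [MOD levelCount m k n (depth y)] := by
  obtain ⟨i, v, c, a, rfl⟩ := exists_eq_succ hx
  refine ⟨⟨i.castSucc, v⟩, ⟨?_, Or.inr ⟨i, v, c, Or.inr ⟨a, rfl⟩, Or.inl rfl⟩⟩, rfl, ?_⟩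
  · intro h
    have : i.val + 1 = i.val := congrArg depth h
    omega
  · change levelCode m k n (i.val + 1) (v, c, a) % levelCount m k n i.val =
      levelCode m k n i.val v % levelCount m k n i.val
    rw [levelCode_succ_mod, Nat.mod_eq_of_lt (levelCode_lt _ _ _ _ _)]

/-- Replaces the cliques by congruences of codes: later arguments about edges only compare moduli by
divisibility. -/
theorem adj_iff {x y : LevelwiseVertex m r k n} :
    (levelwiseGraph m r k n).Adj x y ↔ x ≠ y ∧ ((depth x = 0 ∧ depth y = 0) ∨
      (depth x = depth y + 1 ∧ code x ≡ code y [MOD levelCount m k n (depth y)]) ∨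
      (depth y = depth x + 1 ∧ code y ≡ code x [MOD levelCount m k n (depth x)]) ∨
      ∃ i, depth x = i + 1 ∧ depth y = i + 1 ∧
        code x ≡ code y [MOD levelCount m k n i * k (i + 1)]) := by
  have key : ∀ (i : Fin r) (v : LevelVertex m k n i.val) (c : Fin (k (i.val + 1)))
      (a : Fin (n (i.val + 1))), levelCode m k n (i.val + 1) (v, c, a) ≡
        levelCode m k n i.val v [MOD levelCount m k n i.val] := by
    intro i v c a
    rw [Nat.ModEq, levelCode_succ_mod, Nat.mod_eq_of_lt (levelCode_lt _ _ _ _ _)]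
  constructor
  · rintro ⟨hne, ⟨hx, hy⟩ | ⟨i, v, c, hx, hy⟩⟩
    · exact ⟨hne, Or.inl ⟨mem_initialClique_iff.mp hx, mem_initialClique_iff.mp hy⟩⟩
    · refine ⟨hne, Or.inr ?_⟩
      rcases hx with rfl | ⟨a, rfl⟩ <;> rcases hy with rfl | ⟨b, rfl⟩
      · exact absurd rfl hne
      · exact Or.inr (Or.inl ⟨rfl, key i v c b⟩)
      · exact Or.inl ⟨rfl, key i v c a⟩
      · refine Or.inr (Or.inr ⟨i.val, rfl, rfl, ?_⟩)
        exact (levelCode_succ_mod_mul m k n i.val v c a).trans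
          (levelCode_succ_mod_mul m k n i.val v c b).symm
  · have half : ∀ {x y : LevelwiseVertex m r k n}, depth x = depth y + 1 →
        code x ≡ code y [MOD levelCount m k n (depth y)] →
        (levelwiseGraph m r k n).Adj x y := by
      intro x y hd hc
      obtain ⟨z, hz, hdz, hcz⟩ := exists_parent (x := x) (by omega)
      have hzy : depth z = depth y := by omega
      rw [← hzy] at hc
      rwa [← eq_of_depth_code_modEq hzy (hcz.symm.trans hc)]
    rintro ⟨hne, ⟨hx, hy⟩ | ⟨hd, hc⟩ | ⟨hd, hc⟩ | ⟨i, hx, hy, hc⟩⟩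
    · exact ⟨hne, Or.inl ⟨mem_initialClique_iff.mpr hx, mem_initialClique_iff.mpr hy⟩⟩
    · exact half hd hc
    · exact (half hd hc).symm
    · obtain ⟨j, v, c, a, rfl⟩ := exists_eq_succ (x := x) (by omega)
      obtain ⟨j', v', c', a', rfl⟩ := exists_eq_succ (x := y) (by omega)
      obtain rfl : i = j.val := by
        have : j.val + 1 = i + 1 := hx
        omega
      obtain rfl : j = j' := Fin.ext (by
        have : j'.val + 1 = j.val + 1 := hy
        omega)
      have h1 : levelCode m k n j.val v + levelCount m k n j.val * c.val =
          levelCode m k n j.val v' + levelCount m k n j.val * c'.val := by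
        rw [← levelCode_succ_mod_mul m k n j.val v c a,
          ← levelCode_succ_mod_mul m k n j.val v' c' a']
        exact hc
      have h2 : levelCode m k n j.val v = levelCode m k n j.val v' := by
        have := congrArg (· % levelCount m k n j.val) h1
        simpa [Nat.mod_eq_of_lt (levelCode_lt _ _ _ _ _)] using this
      obtain rfl := levelCode_injective m k n j.val h2
      have hN := (Nat.zero_le _).trans_lt (levelCode_lt m k n j.val v)
      have hcc : c = c' := Fin.ext (Nat.eq_of_mul_eq_mul_left hN (by omega))
      subst hcc
      exact ⟨hne, Or.inr ⟨j, v, c, Or.inr ⟨a, rfl⟩, Or.inr ⟨a', rfl⟩⟩⟩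

/-! ### Distances -/

section
variable {m r : ℕ} {k n : ℕ → ℕ}

theorem exists_walk_to_initialClique (x : LevelwiseVertex m r k n) :
    ∃ w, depth w = 0 ∧ code w ≡ code x [MOD m] ∧
      ∃ p : (levelwiseGraph m r k n).Walk x w, p.length = depth x := by
  induction hd : depth x generalizing x with
  | zero => exact ⟨x, hd, rfl, .nil, rfl⟩
  | succ d ih =>
    obtain ⟨y, hxy, hdy, hc⟩ := exists_parent (x := x) (by omega)
    obtain ⟨w, hw, hcw, p, hp⟩ := ih y (by omega)
    exact ⟨w, hw, hcw.trans (hc.of_dvd (levelCount_dvd m k n (Nat.zero_le _))).symm,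
      .cons hxy p, by simp [hp]⟩

theorem exists_depth_eq_zero (r : ℕ) (k n : ℕ → ℕ) {a : ℕ} (ha : a < m) :
    ∃ w : LevelwiseVertex m r k n, depth w = 0 ∧ code w = a :=
  exists_depth_code (Nat.zero_le r) ha

theorem adj_of_depth_eq_zero {x y : LevelwiseVertex m r k n} (hx : depth x = 0)
    (hy : depth y = 0) (hne : x ≠ y) : (levelwiseGraph m r k n).Adj x y :=
  adj_iff.mpr ⟨hne, Or.inl ⟨hx, hy⟩⟩

theorem levelwiseGraph_connected (hm : 1 ≤ m) : (levelwiseGraph m r k n).Connected := by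
  obtain ⟨w, -, -⟩ := exists_depth_eq_zero r k n hm
  have : Nonempty (LevelwiseVertex m r k n) := ⟨w⟩
  refine ⟨fun x y => ?_⟩
  obtain ⟨u, hu, -, p, -⟩ := exists_walk_to_initialClique x
  obtain ⟨v, hv, -, q, -⟩ := exists_walk_to_initialClique y
  by_cases huv : u = v
  · subst huv
    exact p.reachable.trans q.reachable.symm
  · exact p.reachable.trans ((adj_of_depth_eq_zero hu hv huv).reachable.trans q.reachable.symm)

theorem dist_le_of_code_modEq {x w : LevelwiseVertex m r k n} (hw : depth w = 0)
    (hc : code x ≡ code w [MOD m]) : (levelwiseGraph m r k n).dist x w ≤ depth x := by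
  obtain ⟨u, hu, hcu, p, hp⟩ := exists_walk_to_initialClique x
  obtain rfl : u = w := eq_of_depth_code_modEq (hu.trans hw.symm) (by
    rw [hu]
    exact hcu.trans hc)
  exact hp ▸ SimpleGraph.dist_le p

theorem dist_le_depth_add_one (hm : 1 ≤ m) {x w : LevelwiseVertex m r k n} (hw : depth w = 0) :
    (levelwiseGraph m r k n).dist x w ≤ depth x + 1 := by
  obtain ⟨u, hu, -, p, hp⟩ := exists_walk_to_initialClique x
  have h1 := SimpleGraph.dist_le p
  have h2 : (levelwiseGraph m r k n).dist u w ≤ 1 := by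
    by_cases huw : u = w
    · simp [huw]
    · exact (SimpleGraph.dist_eq_one_iff_adj.mpr (adj_of_depth_eq_zero hu hw huw)).le
  have h3 := (levelwiseGraph_connected (r := r) (k := k) (n := n) hm).dist_triangle
    (u := x) (v := u) (w := w)
  omega

/-- The diameter is `2 * r + crossLength m`. -/
def crossLength (m : ℕ) : ℕ := if m = 1 then 0 else 1

theorem dist_le_depth_add_depth (hm : 1 ≤ m) (x y : LevelwiseVertex m r k n) :
    (levelwiseGraph m r k n).dist x y ≤ depth x + depth y + crossLength m := by
  obtain ⟨w, hw, hcw, -⟩ := exists_walk_to_initialClique y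
  have h1 := dist_le_of_code_modEq hw hcw.symm
  have h2 := (levelwiseGraph_connected (r := r) (k := k) (n := n) hm).dist_triangle
    (u := x) (v := w) (w := y)
  rw [SimpleGraph.dist_comm (u := w)] at h2
  have h3 : (levelwiseGraph m r k n).dist x w ≤ depth x + crossLength m := by
    unfold crossLength
    split_ifs with h
    · exact dist_le_of_code_modEq hw (by subst h; exact Nat.modEq_one)
    · exact dist_le_depth_add_one hm hw
  omega

/-- A potential that drops by at most 1 along each edge drops by at most the length of a geodesic.
All lower bounds on distances rest on this. -/
theorem SimpleGraph.Connected.sub_le_dist {V : Type*} {G : SimpleGraph V} (hG : G.Connected)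
    {φ : V → ℤ} (hφ : ∀ x y, G.Adj x y → φ x - φ y ≤ 1) (x y : V) :
    φ x - φ y ≤ G.dist x y := by
  obtain ⟨p, hp⟩ := hG.exists_walk_length_eq_dist x y
  rw [← hp]
  clear hp
  induction p with
  | nil => simp
  | cons h p ih =>
    have := hφ _ _ h
    simp only [SimpleGraph.Walk.length_cons]
    push_cast
    omega

/-- Vertices of depth at least `h` with a prescribed residue of the code. -/
def residueSet (m r : ℕ) (k n : ℕ → ℕ) (h K a : ℕ) : Set (LevelwiseVertex m r k n) :=
  {z | h ≤ depth z ∧ code z ≡ a [MOD K]}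

theorem mem_residueSet {h K a : ℕ} {x : LevelwiseVertex m r k n} :
    x ∈ residueSet m r k n h K a ↔ h ≤ depth x ∧ code x ≡ a [MOD K] := Iff.rfl

theorem depth_sub_depth_le_one {x y : LevelwiseVertex m r k n}
    (h : (levelwiseGraph m r k n).Adj x y) : (depth x : ℤ) - depth y ≤ 1 := by
  obtain ⟨-, h | h | h | ⟨i, h⟩⟩ := adj_iff.mp h <;> omega

/-- If all edges that leave `S` join depths of sum about `c`, then a path from `S` to its complement
has at least the length that it would have through such an edge. -/
theorem depth_add_depth_sub_le_dist (hm : 1 ≤ m) {S : Set (LevelwiseVertex m r k n)} {c : ℤ}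
    (hS : ∀ x y, (levelwiseGraph m r k n).Adj x y → x ∈ S → y ∉ S →
      (depth x : ℤ) + depth y - c ≤ 1 ∧ c - depth x - depth y ≤ 1)
    {x y : LevelwiseVertex m r k n} (hx : x ∈ S) (hy : y ∉ S) :
    (depth x : ℤ) + depth y - c ≤ (levelwiseGraph m r k n).dist x y := by
  classical
  -- The potential is the depth inside `S` and its reflection `c - depth` outside; `hS` says that it
  -- changes by at most 1 across the boundary.
  have := (levelwiseGraph_connected (r := r) (k := k) (n := n) hm).sub_le_dist
    (φ := fun z => if z ∈ S then (depth z : ℤ) else c - depth z) ?_ x y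
  · simp only [hx, hy, if_true, if_false] at this
    omega
  · intro u v huv
    have h1 := depth_sub_depth_le_one huv
    have h2 := depth_sub_depth_le_one huv.symm
    by_cases hu : u ∈ S <;> by_cases hv : v ∈ S <;> simp only [hu, hv, if_true, if_false]
    · exact h1
    · have := hS u v huv hu hv
      omega
    · have := hS v u huv.symm hv hu
      omega
    · omega

/-- Every edge outside the initial clique is a congruence modulo a multiple of `m`, hence stays in
the tree hanging at one `w^a`. The same divisibility argument serves for the subtree below a single
vertex (`exit_subtree`) and for a joined clique without its attaching vertex, together with all that
hangs below it (`exit_branch`). -/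
theorem exit_initial {a : ℕ} {x y : LevelwiseVertex m r k n}
    (h : (levelwiseGraph m r k n).Adj x y) (hx : x ∈ residueSet m r k n 0 m a)
    (hy : y ∉ residueSet m r k n 0 m a) : depth x = 0 ∧ depth y = 0 := by
  rw [mem_residueSet] at hx hy
  have hdvd : ∀ i, m ∣ levelCount m k n i := fun i => levelCount_dvd m k n (Nat.zero_le i)
  obtain ⟨-, h | ⟨-, h⟩ | ⟨-, h⟩ | ⟨i, -, -, h⟩⟩ := adj_iff.mp h
  · exact h
  · exact absurd ⟨Nat.zero_le _, (h.of_dvd (hdvd _)).symm.trans hx.2⟩ hy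
  · exact absurd ⟨Nat.zero_le _, (h.of_dvd (hdvd _)).trans hx.2⟩ hy
  · exact absurd ⟨Nat.zero_le _, (h.of_dvd ((hdvd i).mul_right _)).symm.trans hx.2⟩ hy

theorem exit_subtree {i a : ℕ} {x y : LevelwiseVertex m r k n}
    (h : (levelwiseGraph m r k n).Adj x y)
    (hx : x ∈ residueSet m r k n (i + 1) (levelCount m k n (i + 1)) a)
    (hy : y ∉ residueSet m r k n (i + 1) (levelCount m k n (i + 1)) a) :
    depth x = i + 1 ∧ (depth y = i ∨ depth y = i + 1) := by
  rw [mem_residueSet] at hx hy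
  obtain ⟨-, h | ⟨hd, h⟩ | ⟨hd, h⟩ | ⟨j, hjx, hjy, h⟩⟩ := adj_iff.mp h
  · omega
  · by_cases hyi : i + 1 ≤ depth y
    · exact absurd ⟨hyi, (h.of_dvd (levelCount_dvd m k n hyi)).symm.trans hx.2⟩ hy
    · omega
  · exact absurd ⟨by omega, (h.of_dvd (levelCount_dvd m k n hx.1)).trans hx.2⟩ hy
  · by_cases hij : i + 1 ≤ j
    · exact absurd ⟨by omega, (h.of_dvd ((levelCount_dvd m k n hij).mul_right _)).symm.trans hx.2⟩
        hy
    · omega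

theorem exit_branch {i a : ℕ} {x y : LevelwiseVertex m r k n}
    (h : (levelwiseGraph m r k n).Adj x y)
    (hx : x ∈ residueSet m r k n (i + 1) (levelCount m k n i * k (i + 1)) a)
    (hy : y ∉ residueSet m r k n (i + 1) (levelCount m k n i * k (i + 1)) a) :
    depth x = i + 1 ∧ depth y = i ∧ code y ≡ a [MOD levelCount m k n i] := by
  rw [mem_residueSet] at hx hy
  obtain ⟨-, h | ⟨hd, h⟩ | ⟨hd, h⟩ | ⟨j, hjx, hjy, h⟩⟩ := adj_iff.mp h
  · omega
  · by_cases hyi : i + 1 ≤ depth y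
    · exact absurd ⟨hyi, (h.of_dvd (levelCount_mul_dvd m k n hyi)).symm.trans hx.2⟩ hy
    · obtain rfl : depth y = i := by omega
      exact ⟨hd, rfl, h.symm.trans (hx.2.of_dvd (Dvd.intro _ rfl))⟩
  · exact absurd ⟨by omega, (h.of_dvd (levelCount_mul_dvd m k n hx.1)).trans hx.2⟩ hy
  · rcases Nat.lt_or_ge i j with hij | hij
    · exact absurd ⟨by omega, (h.of_dvd ((levelCount_mul_dvd m k n hij).mul_right _)).symm.trans
        hx.2⟩ hy
    · obtain rfl : j = i := by omega
      exact absurd ⟨by omega, h.symm.trans hx.2⟩ hy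

theorem depth_add_depth_add_one_le_dist (hm : 1 ≤ m) {x y : LevelwiseVertex m r k n}
    (h : ¬ code y ≡ code x [MOD m]) :
    depth x + depth y + 1 ≤ (levelwiseGraph m r k n).dist x y := by
  -- Exit edges have depth sum 0, and `-1` is the least admissible `c`. Likewise the least values
  -- are `0` for branches and `2 * h + 1` for subtrees.
  have := depth_add_depth_sub_le_dist hm (S := residueSet m r k n 0 m (code x)) (c := -1)
    (fun u v huv hu hv => by have := exit_initial huv hu hv; omega)
    (x := x) (y := y) ⟨Nat.zero_le _, rfl⟩ (fun hy => h hy.2)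
  omega

/-- Vertices in different branches at the vertex of an initial clique of order one. -/
theorem depth_add_depth_le_dist {x y : LevelwiseVertex 1 r k n} (hx : depth x ≠ 0)
    (h : depth y = 0 ∨ ¬ code y ≡ code x [MOD k 1]) :
    depth x + depth y ≤ (levelwiseGraph 1 r k n).dist x y := by
  have := depth_add_depth_sub_le_dist le_rfl
    (S := residueSet 1 r k n (0 + 1) (levelCount 1 k n 0 * k (0 + 1)) (code x)) (c := 0)
    (fun u v huv hu hv => by have := exit_branch huv hu hv; omega)
    (x := x) (y := y) ⟨by omega, rfl⟩ (by
      rw [mem_residueSet, levelCount, one_mul]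
      rintro ⟨h1, h2⟩
      rcases h with h | h
      · omega
      · exact h h2)
  omega

/-- The distance is bounded below in terms of the depth `h` of the last common ancestor. -/
theorem exists_common_ancestor (hm : 1 ≤ m) {x y : LevelwiseVertex m r k n} (hne : x ≠ y)
    (h0 : code x ≡ code y [MOD m]) :
    ∃ h, h ≤ depth x ∧ h ≤ depth y ∧ code x ≡ code y [MOD levelCount m k n h] ∧
      depth x + depth y ≤ (levelwiseGraph m r k n).dist x y + 2 * h + 1 := by
  classical
  let P : ℕ → Prop := fun h =>
    h ≤ depth x ∧ h ≤ depth y ∧ code x ≡ code y [MOD levelCount m k n h]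
  obtain ⟨h, hP, hmax⟩ : ∃ h, P h ∧ ¬ P (h + 1) := by
    by_contra! hcon
    have : ∀ h, P h := fun h => by
      induction h with
      | zero => exact ⟨Nat.zero_le _, Nat.zero_le _, h0⟩
      | succ h ih => exact hcon h ih
    have := (this (depth x + 1)).1
    omega
  refine ⟨h, hP.1, hP.2.1, hP.2.2, ?_⟩
  have key : ∀ {u v : LevelwiseVertex m r k n}, h + 1 ≤ depth u →
      ¬ (h + 1 ≤ depth v ∧ code v ≡ code u [MOD levelCount m k n (h + 1)]) →
      depth u + depth v ≤ (levelwiseGraph m r k n).dist u v + 2 * h + 1 := by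
    intro u v hu huv
    have := depth_add_depth_sub_le_dist hm
      (S := residueSet m r k n (h + 1) (levelCount m k n (h + 1)) (code u)) (c := 2 * h + 1)
      (fun u v huv hu hv => by have := exit_subtree huv hu hv; omega)
      (x := u) (y := v) ⟨hu, rfl⟩ huv
    omega
  by_cases hx : h + 1 ≤ depth x
  · exact key hx fun hy => hmax ⟨hx, hy.1, hy.2.symm⟩
  · by_cases hy : h + 1 ≤ depth y
    · have := key hy fun hx => hmax ⟨hx.1, hy, hx.2⟩
      rw [SimpleGraph.dist_comm]
      omega
    · obtain ⟨h1, h2, h3⟩ := hP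
      obtain rfl : h = depth x := by omega
      exact absurd (eq_of_depth_code_modEq (by omega) h3) hne

end

/-! ### Blocks -/

section
variable {m r : ℕ} {k n : ℕ → ℕ}

/-- A set of vertices whose only outside neighbour is `p` cannot cut a set without
cut-vertices. -/
theorem InducesTwoConnected.eq_of_exit {V : Type*} [Finite V] {G : SimpleGraph V} {S T : Set V}
    (hS : InducesTwoConnected G S) {p : V} (hp : p ∉ T)
    (hT : ∀ x y, G.Adj x y → x ∈ T → y ∉ T → y = p) {u v : V} (hu : u ∈ S) (huT : u ∈ T)
    (hv : v ∈ S) (hvT : v ∉ T) : v = p := by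
  by_contra hvp
  -- A walk that avoids `p` cannot leave `T`. This is used in `G.induce S`, to see that `p ∈ S`, and
  -- then in the same graph without `p`.
  have closed : ∀ {W : Type _} {H : SimpleGraph W} (g : H →g G), (∀ w, g w ≠ p) →
      ∀ {a b : W}, H.Reachable a b → g a ∈ T → g b ∈ T := by
    rintro W H g hg a b ⟨q⟩ ha
    induction q with
    | nil => exact ha
    | cons hab q ih =>
      refine ih ?_
      by_contra hb
      exact hg _ (hT _ _ (g.map_adj hab) ha hb)
  have hpS : p ∈ S := by
    by_contra hpS
    exact hvT (closed (SimpleGraph.Embedding.induce S).toHom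
      (fun w hw => hpS (hw ▸ w.2)) (hS.1.preconnected ⟨u, hu⟩ ⟨v, hv⟩) huT)
  refine hS.2 ⟨p, hpS⟩ ?_
  have hup : u ≠ p := fun h => hp (h ▸ huT)
  have h1 : Nat.card (G.induce S).ConnectedComponent ≤ 1 := by
    have := hS.1.preconnected.subsingleton_connectedComponent
    exact Finite.card_le_one_iff_subsingleton.mpr this
  refine h1.trans_lt ?_
  let H := (G.induce S).induce {(⟨p, hpS⟩ : S)}ᶜ
  have : Nontrivial H.ConnectedComponent := by
    refine ⟨H.connectedComponentMk ⟨⟨u, hu⟩, fun h => hup (congrArg Subtype.val h)⟩,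
      H.connectedComponentMk ⟨⟨v, hv⟩, fun h => hvp (congrArg Subtype.val h)⟩, fun h => ?_⟩
    exact hvT (closed ((SimpleGraph.Embedding.induce S).toHom.comp
      (SimpleGraph.Embedding.induce {(⟨p, hpS⟩ : S)}ᶜ).toHom)
      (fun w hw => w.2 (Subtype.ext hw)) (SimpleGraph.ConnectedComponent.exact h) huT)
  exact Finite.one_lt_card

/-- For the deeper vertex `u` of a pair, the branch containing `u` at its parent `p` is left only
through `p`. The other vertex is thus `p` itself or lies in the branch, and then, being no deeper
than `u`, in the same joined clique. -/
theorem InducesTwoConnected.isClique {S : Set (LevelwiseVertex m r k n)}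
    (hS : InducesTwoConnected (levelwiseGraph m r k n) S) :
    (levelwiseGraph m r k n).IsClique S := by
  have key : ∀ {u v : LevelwiseVertex m r k n}, u ∈ S → v ∈ S → u ≠ v → depth v ≤ depth u →
      (levelwiseGraph m r k n).Adj u v := by
    intro u v hu hv hne hle
    by_cases hu0 : depth u = 0
    · exact adj_of_depth_eq_zero hu0 (by omega) hne
    · obtain ⟨p, hup, hd, hc⟩ := exists_parent hu0
      let T := residueSet m r k n (depth p + 1) (levelCount m k n (depth p) * k (depth p + 1))
        (code u)
      have huT : u ∈ T := ⟨hd.ge, rfl⟩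
      by_cases hvT : v ∈ T
      · have hvd : depth v = depth p + 1 := le_antisymm (hd ▸ hle) hvT.1
        exact adj_iff.mpr ⟨hne, Or.inr (Or.inr (Or.inr ⟨_, hd, hvd, hvT.2.symm⟩))⟩
      · have : v = p := hS.eq_of_exit (T := T) (fun h => by have := h.1; omega)
          (fun x y hxy hx hy => by
            obtain ⟨-, h1, h2⟩ := exit_branch hxy hx hy
            refine eq_of_depth_code_modEq h1 ?_
            rw [h1]
            exact h2.trans hc) hu huT hv hvT
        exact this ▸ hup
  intro u hu v hv hne
  rcases le_total (depth v) (depth u) with h | h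
  · exact key hu hv hne h
  · exact (key hv hu hne.symm h).symm

theorem levelwiseGraph_isBlockGraph (hm : 1 ≤ m) : IsBlockGraph (levelwiseGraph m r k n) :=
  ⟨levelwiseGraph_connected hm, fun _ hB => InducesTwoConnected.isClique hB.1⟩

theorem inducesTwoConnected_of_isClique {V : Type*} [Finite V] {G : SimpleGraph V} {S : Set V}
    (hS : G.IsClique S) (hne : S.Nonempty) : InducesTwoConnected G S := by
  have hadj : ∀ u v : S, (G.induce S).Reachable u v := fun u v => by
    by_cases huv : u = v
    · rw [huv]
    · exact SimpleGraph.Adj.reachable (hS u.2 v.2 fun h => huv (Subtype.ext h))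
  have : Nonempty S := hne.to_subtype
  refine ⟨⟨hadj⟩, fun v => not_lt.mpr ?_⟩
  have h1 : 0 < Nat.card (G.induce S).ConnectedComponent := by
    have : Nonempty (G.induce S).ConnectedComponent := ⟨(G.induce S).connectedComponentMk v⟩
    exact Nat.card_pos
  refine le_trans (Finite.card_le_one_iff_subsingleton.mpr ?_) h1
  refine SimpleGraph.Preconnected.subsingleton_connectedComponent fun a b => ?_
  by_cases hab : a = b
  · rw [hab]
  · exact SimpleGraph.Adj.reachable
      (hS a.1.2 b.1.2 fun h => hab (Subtype.ext (Subtype.ext h)))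

/-- A clique that contains an initial clique of order at least two is equal to it. -/
theorem depth_eq_zero_of_isClique (hm : 2 ≤ m) {S : Set (LevelwiseVertex m r k n)}
    (hS : (levelwiseGraph m r k n).IsClique S) (hsub : {v | depth v = 0} ⊆ S)
    {x : LevelwiseVertex m r k n} (hx : x ∈ S) : depth x = 0 := by
  obtain ⟨w, hw, hcw⟩ := exists_depth_eq_zero (m := m) r k n (a := 0) (by omega)
  obtain ⟨w', hw', hcw'⟩ := exists_depth_eq_zero (m := m) r k n (a := 1) (by omega)
  by_contra hx0
  have key : ∀ {z : LevelwiseVertex m r k n}, depth z = 0 → code x ≡ code z [MOD m] := by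
    intro z hz
    have hadj := hS hx (hsub hz) (fun h => hx0 (h ▸ hz))
    obtain ⟨-, h | ⟨hd, h⟩ | h | ⟨i, h⟩⟩ := adj_iff.mp hadj
    · omega
    · rw [hz] at h
      exact h
    · omega
    · omega
  have h := (key hw).symm.trans (key hw')
  rw [hcw, hcw'] at h
  have := h.eq_of_lt_of_lt (by omega) (by omega)
  omega

theorem isBlock_iff_of_initialClique_subset (hm : 2 ≤ m) {B : Set (LevelwiseVertex m r k n)}
    (hsub : {v | depth v = 0} ⊆ B) :
    IsBlock (levelwiseGraph m r k n) B ↔ B = {v | depth v = 0} := by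
  constructor
  · intro hB
    exact Set.Subset.antisymm
      (fun x hx => depth_eq_zero_of_isClique hm (InducesTwoConnected.isClique hB.1) hsub hx) hsub
  · rintro rfl
    obtain ⟨w, hw, -⟩ := exists_depth_eq_zero (m := m) r k n (a := 0) (by omega)
    refine ⟨inducesTwoConnected_of_isClique
      (fun u hu v hv hne => adj_of_depth_eq_zero hu hv hne) ⟨w, hw⟩, fun S hS hle x hx => ?_⟩
    exact depth_eq_zero_of_isClique hm (InducesTwoConnected.isClique hS) hle hx

end

/-! ### Weight centers and levels -/

section
variable {m r : ℕ} {k n : ℕ → ℕ}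

theorem sum_levelVertex {M : Type*} [AddCommMonoid M] (m : ℕ) (k n : ℕ → ℕ) (i : ℕ) (g : ℕ → M) :
    ∑ v : LevelVertex m k n i, g (levelCode m k n i v) =
      ∑ q ∈ Finset.range (levelCount m k n i), g q := by
  refine Finset.sum_nbij (levelCode m k n i) (fun v _ => ?_)
    (fun v _ w _ h => levelCode_injective m k n i h) (fun q hq => ?_) (fun _ _ => rfl)
  · exact Finset.mem_range.mpr (levelCode_lt m k n i v)
  · obtain ⟨v, hv⟩ := exists_levelCode_eq m k n i (Finset.mem_range.mp (Finset.mem_coe.mp hq))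
    exact ⟨v, Finset.mem_coe.mpr (Finset.mem_univ v), hv⟩

theorem sum_levelwiseVertex {M : Type*} [AddCommMonoid M] (m r : ℕ) (k n : ℕ → ℕ)
    (g : ℕ → ℕ → M) :
    ∑ x : LevelwiseVertex m r k n, g (depth x) (code x) =
      ∑ i ∈ Finset.range (r + 1), ∑ q ∈ Finset.range (levelCount m k n i), g i q := by
  rw [Fintype.sum_sigma, ← Fin.sum_univ_eq_sum_range
    (fun i => ∑ q ∈ Finset.range (levelCount m k n i), g i q)]
  exact Finset.sum_congr rfl fun i _ => sum_levelVertex m k n i.val (g i.val)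

theorem sum_depth (m r : ℕ) (k n : ℕ → ℕ) (g : ℕ → ℕ) :
    ∑ x : LevelwiseVertex m r k n, g (depth x) =
      ∑ i ∈ Finset.range (r + 1), g i * levelCount m k n i := by
  rw [sum_levelwiseVertex m r k n fun i _ => g i]
  simp [mul_comm]

theorem card_levelwiseVertex (m r : ℕ) (k n : ℕ → ℕ) :
    Fintype.card (LevelwiseVertex m r k n) =
      ∑ i ∈ Finset.range (r + 1), levelCount m k n i := by
  simpa using sum_depth m r k n fun _ => 1

open Classical in
-- At each depth the codes fill an initial interval whose length is a multiple of `K`, so all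
-- residues occur equally often.
theorem mul_card_residueSet {h K : ℕ} (a : ℕ) (hK : 0 < K)
    (hdvd : ∀ i, h ≤ i → K ∣ levelCount m k n i) :
    K * (Finset.univ.filter (· ∈ residueSet m r k n h K a)).card =
      ∑ i ∈ Finset.range (r + 1), if h ≤ i then levelCount m k n i else 0 := by
  rw [Finset.card_filter]
  have := sum_levelwiseVertex m r k n fun i q => if h ≤ i ∧ q ≡ a [MOD K] then 1 else 0
  simp only [mem_residueSet]
  rw [this, Finset.mul_sum]
  refine Finset.sum_congr rfl fun i _ => ?_
  by_cases hi : h ≤ i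
  · simp only [hi, true_and, if_true]
    rw [← Finset.card_filter, ← Nat.count_eq_card_filter_range, Nat.count_modEq_card _ hK,
      Nat.mod_eq_zero_of_dvd (hdvd i hi), if_neg (Nat.not_lt_zero _), add_zero,
      Nat.mul_div_cancel' (hdvd i hi)]
  · simp [hi]

theorem dist_eq_depth {x w : LevelwiseVertex m r k n} (hm : 1 ≤ m) (hw : depth w = 0)
    (hc : code x ≡ code w [MOD m]) : (levelwiseGraph m r k n).dist x w = depth x := by
  have h1 := dist_le_of_code_modEq hw hc
  have h2 := (levelwiseGraph_connected (r := r) (k := k) (n := n) hm).sub_le_dist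
    (φ := fun z => (depth z : ℤ)) (fun _ _ h => depth_sub_depth_le_one h) x w
  simp only [hw] at h2
  omega

theorem dist_eq_depth_add_one {x w : LevelwiseVertex m r k n} (hm : 1 ≤ m) (hw : depth w = 0)
    (hc : ¬ code x ≡ code w [MOD m]) :
    (levelwiseGraph m r k n).dist x w = depth x + 1 := by
  have h1 := dist_le_depth_add_one hm (x := x) hw
  have h2 := depth_add_depth_add_one_le_dist hm (x := x) (y := w) fun h => hc h.symm
  omega

open Classical in
-- The weight depends on `w` only through the size of its own tree, where distances to `w` are
-- shorter by one; these trees are equally large.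
theorem weightAt_add_card {w : LevelwiseVertex m r k n} (hm : 1 ≤ m) (hw : depth w = 0) :
    weightAt (levelwiseGraph m r k n) w +
        (Finset.univ.filter (· ∈ residueSet m r k n 0 m (code w))).card =
      ∑ x : LevelwiseVertex m r k n, (depth x + 1) := by
  rw [weightAt, Finset.card_filter, ← Finset.sum_add_distrib]
  refine Finset.sum_congr rfl fun x _ => ?_
  simp only [mem_residueSet]
  by_cases hc : code x ≡ code w [MOD m]
  · simp [hc, dist_eq_depth hm hw hc]
  · simp [hc, dist_eq_depth_add_one hm hw hc]

theorem weightAt_eq_of_depth_eq_zero {w w' : LevelwiseVertex m r k n} (hm : 1 ≤ m)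
    (hw : depth w = 0) (hw' : depth w' = 0) :
    weightAt (levelwiseGraph m r k n) w = weightAt (levelwiseGraph m r k n) w' := by
  classical
  have h1 := weightAt_add_card hm hw
  have h2 := weightAt_add_card hm hw'
  have hd : ∀ i, 0 ≤ i → m ∣ levelCount m k n i := fun i hi => levelCount_dvd m k n hi
  have h3 := mul_card_residueSet (r := r) (code w) hm hd
  rw [← mul_card_residueSet (r := r) (code w') hm hd] at h3
  have h4 := Nat.eq_of_mul_eq_mul_left hm h3
  omega

theorem levelCount_pos (hm : 1 ≤ m) (hk : ∀ i ∈ Finset.Icc 1 r, 1 ≤ k i)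
    (hn : ∀ i ∈ Finset.Icc 1 r, 2 ≤ n i) {i : ℕ} (hi : i ≤ r) : 0 < levelCount m k n i := by
  induction i with
  | zero => exact hm
  | succ i ih =>
    have hmem : i + 1 ∈ Finset.Icc 1 r := Finset.mem_Icc.mpr ⟨by omega, hi⟩
    exact Nat.mul_pos (ih (by omega))
      (Nat.mul_pos (hk _ hmem) (lt_of_lt_of_le two_pos (hn _ hmem)))

/-- A vertex `v` outside the initial clique lies in a branch with less than half of the vertices,
such that all paths from the complement of the branch to `v` go through the initial clique. -/
theorem exists_branch (hm : 1 ≤ m) (hm2 : m ≠ 2) (hk1 : m = 1 → 2 ≤ k 1)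
    {v : LevelwiseVertex m r k n} (hv : depth v ≠ 0) :
    ∃ B : Finset (LevelwiseVertex m r k n), 2 * B.card < Fintype.card (LevelwiseVertex m r k n) ∧
      ∀ u ∉ B, depth u + depth v + crossLength m ≤ (levelwiseGraph m r k n).dist u v := by
  classical
  have hcard := card_levelwiseVertex m r k n
  by_cases h1 : m = 1
  · subst h1
    have hB := mul_card_residueSet (m := 1) (r := r) (k := k) (n := n) (h := 1) (K := k 1) (code v)
      (by have := hk1 rfl; omega) (fun i hi => by
        have := levelCount_mul_dvd 1 k n (Nat.lt_of_succ_le hi)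
        rwa [levelCount, one_mul] at this)
    refine ⟨Finset.univ.filter (· ∈ residueSet 1 r k n 1 (k 1) (code v)), ?_, fun u hu => ?_⟩
    -- The branches share all vertices but the root equally and there are at least two; the root
    -- makes the inequality strict.
    · rw [Finset.sum_range_succ'] at hB hcard
      simp only [Nat.le_add_left, if_true, levelCount,
        show ¬ 1 ≤ 0 by omega, if_false] at hB hcard
      have := Nat.mul_le_mul_right
        (Finset.univ.filter (· ∈ residueSet 1 r k n 1 (k 1) (code v))).card (hk1 rfl)
      omega
    · rw [Finset.mem_filter, mem_residueSet] at hu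
      have := depth_add_depth_le_dist (x := v) (y := u) hv (by
        by_contra! hcon
        exact hu ⟨Finset.mem_univ _, by omega, hcon.2⟩)
      rw [SimpleGraph.dist_comm, crossLength, if_pos rfl]
      omega
  · have hB := mul_card_residueSet (m := m) (r := r) (k := k) (n := n) (h := 0) (K := m) (code v)
      hm (fun i hi => levelCount_dvd m k n hi)
    simp only [Nat.zero_le, if_true] at hB
    rw [← hcard] at hB
    refine ⟨Finset.univ.filter (· ∈ residueSet m r k n 0 m (code v)), ?_, fun u hu => ?_⟩
    -- One of `m ≥ 3` equal trees; for `m = 2` it would be exactly half.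
    · have := Nat.mul_le_mul_right
        (Finset.univ.filter (· ∈ residueSet m r k n 0 m (code v))).card
        (show 3 ≤ m by omega)
      have : 0 < Fintype.card (LevelwiseVertex m r k n) := Fintype.card_pos_iff.mpr ⟨v⟩
      omega
    · rw [Finset.mem_filter, mem_residueSet] at hu
      have := depth_add_depth_add_one_le_dist hm (x := v) (y := u) fun h =>
        hu ⟨Finset.mem_univ _, Nat.zero_le _, h⟩
      rw [SimpleGraph.dist_comm, crossLength, if_neg h1]
      omega

/-- Moving from `v` to its ancestor `w` in the initial clique brings all vertices outside the branch
closer by at least `depth v`, and those inside recede by at most `depth v`; the former are the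
majority. -/
theorem weightAt_lt (hm : 1 ≤ m) (hm2 : m ≠ 2) (hk1 : m = 1 → 2 ≤ k 1)
    {v w : LevelwiseVertex m r k n} (hv : depth v ≠ 0) (hw : depth w = 0)
    (hc : code v ≡ code w [MOD m]) :
    weightAt (levelwiseGraph m r k n) w < weightAt (levelwiseGraph m r k n) v := by
  classical
  obtain ⟨B, hB, hdist⟩ := exists_branch hm hm2 hk1 hv
  have hconn := levelwiseGraph_connected (r := r) (k := k) (n := n) hm
  have hvw := dist_eq_depth hm hw hc
  have key : ∀ u, (levelwiseGraph m r k n).dist u w + depth v ≤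
      (levelwiseGraph m r k n).dist u v + if u ∈ B then 2 * depth v else 0 := by
    intro u
    split_ifs with hu
    · have := hconn.dist_triangle (u := u) (v := v) (w := w)
      omega
    · have h1 := hdist u hu
      have h2 := dist_le_depth_add_depth hm u w
      omega
  have hsum := Finset.sum_le_sum fun u (_ : u ∈ Finset.univ) => key u
  rw [Finset.sum_add_distrib, Finset.sum_add_distrib, Finset.sum_const, Finset.sum_ite_mem,
    Finset.univ_inter, Finset.sum_const, Finset.card_univ, smul_eq_mul, smul_eq_mul] at hsum
  have h3 := Nat.mul_lt_mul_of_pos_right hB (Nat.pos_of_ne_zero hv)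
  have h4 : B.card * (2 * depth v) = 2 * B.card * depth v := by ring
  unfold weightAt
  omega

theorem weightCenters_levelwiseGraph (hm : 1 ≤ m) (hm2 : m ≠ 2) (hk1 : m = 1 → 2 ≤ k 1) :
    weightCenters (levelwiseGraph m r k n) = {v | depth v = 0} := by
  obtain ⟨w, hw, -⟩ := exists_depth_eq_zero r k n hm
  have hle : ∀ v, weightAt (levelwiseGraph m r k n) w ≤ weightAt (levelwiseGraph m r k n) v ∧
      (depth v ≠ 0 → weightAt (levelwiseGraph m r k n) w <
        weightAt (levelwiseGraph m r k n) v) := by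
    intro v
    by_cases hv : depth v = 0
    · exact ⟨(weightAt_eq_of_depth_eq_zero hm hw hv).le, fun h => absurd hv h⟩
    · obtain ⟨u, hu, hcu, -⟩ := exists_walk_to_initialClique v
      have := weightAt_lt hm hm2 hk1 hv hu hcu.symm
      rw [weightAt_eq_of_depth_eq_zero hm hu hw] at this
      exact ⟨this.le, fun _ => this⟩
  have : Nonempty (LevelwiseVertex m r k n) := ⟨w⟩
  have hmin : graphWeight (levelwiseGraph m r k n) = weightAt (levelwiseGraph m r k n) w :=
    le_antisymm (ciInf_le (OrderBot.bddBelow _) w) (le_ciInf fun v => (hle v).1)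
  ext v
  rw [weightCenters, Set.mem_ofPred_eq, Set.mem_ofPred_eq, hmin]
  constructor
  · intro h
    by_contra hv
    exact ((hle v).2 hv).ne' h
  · exact fun hv => weightAt_eq_of_depth_eq_zero hm hv hw

theorem ncard_depth_eq_zero (m r : ℕ) (k n : ℕ → ℕ) :
    {v : LevelwiseVertex m r k n | depth v = 0}.ncard = m := by
  classical
  rw [Set.ncard_eq_toFinset_card', Set.toFinset_ofPred, Finset.card_filter]
  have := sum_depth m r k n fun d => if d = 0 then 1 else 0
  rw [Finset.sum_range_succ'] at this
  simpa [levelCount] using this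

/-- Makes the sum of diameter and ε equal to `2 * r + 1` in both cases. -/
theorem centerEps_add_crossLength (hm : 1 ≤ m) (hm2 : m ≠ 2) (hk1 : m = 1 → 2 ≤ k 1) :
    centerEps (levelwiseGraph m r k n) + crossLength m = 1 := by
  rw [centerEps, weightCenters_levelwiseGraph hm hm2 hk1, ncard_depth_eq_zero, crossLength]
  split_ifs <;> rfl

theorem isCentralVertex_iff (hm : 1 ≤ m) (hm2 : m ≠ 2) (hk1 : m = 1 → 2 ≤ k 1)
    {v : LevelwiseVertex m r k n} :
    IsCentralVertex (levelwiseGraph m r k n) v ↔ depth v = 0 := by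
  rw [IsCentralVertex, weightCenters_levelwiseGraph hm hm2 hk1, ncard_depth_eq_zero]
  constructor
  · rintro (h | ⟨h2, B, hB, hsub, hv⟩)
    · exact h.symm.subset (Set.mem_singleton v)
    · exact (((isBlock_iff_of_initialClique_subset h2 hsub).mp hB).subset hv :)
  · intro hv
    by_cases h1 : m = 1
    · left
      refine Set.eq_singleton_iff_unique_mem.mpr ⟨hv, fun u hu => ?_⟩
      subst h1
      have hu0 : depth u = 0 := hu
      refine eq_of_depth_code_modEq (hu0.trans hv.symm) ?_
      rw [hu0]
      exact Nat.modEq_one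
    · exact Or.inr ⟨by omega, _,
        (isBlock_iff_of_initialClique_subset (by omega) subset_rfl).mpr rfl, subset_rfl, hv⟩

theorem vertexLevel_levelwiseGraph (hm : 1 ≤ m) (hm2 : m ≠ 2) (hk1 : m = 1 → 2 ≤ k 1)
    (v : LevelwiseVertex m r k n) : vertexLevel (levelwiseGraph m r k n) v = depth v := by
  obtain ⟨w, hw, hcw, -⟩ := exists_walk_to_initialClique v
  refine le_antisymm ?_ ?_
  · rw [← dist_eq_depth hm hw hcw.symm]
    exact Nat.sInf_le ⟨w, (isCentralVertex_iff hm hm2 hk1).mpr hw, rfl⟩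
  · refine le_csInf ⟨_, w, (isCentralVertex_iff hm hm2 hk1).mpr hw, rfl⟩ ?_
    rintro l ⟨u, hu, rfl⟩
    rw [isCentralVertex_iff hm hm2 hk1] at hu
    by_cases hc : code v ≡ code u [MOD m]
    · exact (dist_eq_depth hm hu hc).ge
    · have := dist_eq_depth_add_one hm hu hc
      omega

theorem totalLevel_levelwiseGraph (hm : 1 ≤ m) (hm2 : m ≠ 2) (hk1 : m = 1 → 2 ≤ k 1) :
    totalLevel (levelwiseGraph m r k n) = ∑ v : LevelwiseVertex m r k n, depth v :=
  Finset.sum_congr rfl fun v _ => vertexLevel_levelwiseGraph hm hm2 hk1 v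

theorem diam_levelwiseGraph (hm : 1 ≤ m) (hr : 1 ≤ r) (hk : ∀ i ∈ Finset.Icc 1 r, 1 ≤ k i)
    (hn : ∀ i ∈ Finset.Icc 1 r, 2 ≤ n i) (hk1 : m = 1 → 2 ≤ k 1) :
    (levelwiseGraph m r k n).diam = 2 * r + crossLength m := by
  have hconn := levelwiseGraph_connected (r := r) (k := k) (n := n) hm
  have : Nonempty (LevelwiseVertex m r k n) := hconn.nonempty
  refine le_antisymm ?_ ?_
  · obtain ⟨u, v, huv⟩ := (levelwiseGraph m r k n).exists_dist_eq_diam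
    rw [← huv]
    have h1 := dist_le_depth_add_depth hm u v
    have h2 := depth_le u
    have h3 := depth_le v
    omega
  · have hpos := levelCount_pos hm hk hn le_rfl
    have htwo : 1 < levelCount m k n r := by
      have hd := levelCount_dvd m k n hr
      refine lt_of_lt_of_le ?_ (Nat.le_of_dvd hpos hd)
      have hmem : 1 ∈ Finset.Icc 1 r := Finset.mem_Icc.mpr ⟨le_rfl, hr⟩
      have h1 : 1 * 2 ≤ k 1 * n 1 := Nat.mul_le_mul (hk 1 hmem) (hn 1 hmem)
      have h2 : 1 * (1 * 2) ≤ m * (k 1 * n 1) := Nat.mul_le_mul hm h1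
      change 1 < m * (k 1 * n 1)
      omega
    -- The deepest vertices with codes 0 and 1 lie in different trees, or for `m = 1` in different
    -- branches because `k 1 ≥ 2`.
    obtain ⟨u, hu, hcu⟩ := exists_depth_code (m := m) (r := r) (k := k) (n := n) le_rfl hpos
    obtain ⟨v, hv, hcv⟩ := exists_depth_code (m := m) (r := r) (k := k) (n := n) le_rfl htwo
    have hdiam : (levelwiseGraph m r k n).dist u v ≤ (levelwiseGraph m r k n).diam :=
      SimpleGraph.dist_le_diam (SimpleGraph.connected_iff_ediam_ne_top.mp hconn)
    refine le_trans ?_ hdiam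
    by_cases h1 : m = 1
    · subst h1
      have := depth_add_depth_le_dist (x := u) (y := v) (by omega) (Or.inr fun h => by
        rw [hcu, hcv] at h
        have h2 := hk1 rfl
        have := h.eq_of_lt_of_lt (by omega) (by omega)
        omega)
      rw [crossLength, if_pos rfl]
      omega
    · have := depth_add_depth_add_one_le_dist hm (x := u) (y := v) (fun h => by
        rw [hcu, hcv] at h
        have := h.eq_of_lt_of_lt (by omega) (by omega)
        omega)
      rw [crossLength, if_neg h1]
      omega

end

/-! ### The lower bound for the span -/

section

/-- Vertices are added by increasing label and only the new maximum is compared with the previous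
one. Interior vertices enter two gaps and the end vertices `a`, `b` one each, which explains the
terms `L a + L b`. -/
theorem exists_le_sub_of_pairwise {V : Type*} [DecidableEq V] {f L : V → ℕ} {D : ℤ}
    (hf : ∀ u v, u ≠ v → D - L u - L v ≤ |(f u : ℤ) - f v|) (A : Finset V) (hA : A.Nonempty) :
    ∃ a ∈ A, ∃ b ∈ A, (∀ c ∈ A, f c ≤ f b) ∧ (1 < A.card → a ≠ b) ∧
      ((A.card : ℤ) - 1) * D - 2 * ∑ v ∈ A, (L v : ℤ) + L a + L b ≤ (f b : ℤ) - f a := by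
  induction A using Finset.induction_on_max_value f with
  | empty => exact absurd hA Finset.not_nonempty_empty
  | insert b A hb hmax ih =>
    rcases A.eq_empty_or_nonempty with rfl | hA
    · refine ⟨b, by simp, b, by simp, by simp, by simp, ?_⟩
      simp
      omega
    · obtain ⟨a, ha, c, hc, -, -, h⟩ := ih hA
      refine ⟨a, Finset.mem_insert_of_mem ha, b, Finset.mem_insert_self b A, ?_, ?_, ?_⟩
      · simpa using hmax
      · rintro - rfl
        exact hb ha
      · have h1 := hf b c fun h => hb (h ▸ hc)
        rw [abs_of_nonneg (by have := hmax c hc; omega)] at h1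
        rw [Finset.card_insert_of_notMem hb, Finset.sum_insert hb]
        push_cast
        linarith

theorem natAbs_sub_le_labelingSpan {V : Type*} [Fintype V] (f : V → ℕ) (u v : V) :
    ((f u : ℤ) - f v).natAbs ≤ labelingSpan f :=
  Finset.le_sup (f := fun p : V × V => ((f p.1 : ℤ) - (f p.2 : ℤ)).natAbs)
    (Finset.mem_univ (u, v))

theorem radioNumber_le {V : Type*} [Fintype V] {G : SimpleGraph V} {f : V → ℕ}
    (hf : IsRadioLabeling G f) {s : ℕ} (hs : ∀ u v, ((f u : ℤ) - f v).natAbs ≤ s) :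
    radioNumber G ≤ s := by
  have h : labelingSpan f ≤ s := Finset.sup_le fun p _ => hs p.1 p.2
  exact le_trans (Nat.sInf_le ⟨f, hf, rfl⟩) h

variable {m r : ℕ} {k n : ℕ → ℕ}

theorem le_labelingSpan (hm : 1 ≤ m) (hm2 : m ≠ 2) (hr : 1 ≤ r)
    (hk : ∀ i ∈ Finset.Icc 1 r, 1 ≤ k i) (hn : ∀ i ∈ Finset.Icc 1 r, 2 ≤ n i)
    (hk1 : m = 1 → 2 ≤ k 1) {f : LevelwiseVertex m r k n → ℕ}
    (hf : IsRadioLabeling (levelwiseGraph m r k n) f) :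
    ((Fintype.card (LevelwiseVertex m r k n) : ℤ) - 1) * (2 * r + 1)
      - 2 * ∑ v : LevelwiseVertex m r k n, (depth v : ℤ)
      + centerEps (levelwiseGraph m r k n) ≤ labelingSpan f := by
  classical
  have heps := centerEps_add_crossLength (r := r) (n := n) hm hm2 hk1
  have hdiam := diam_levelwiseGraph hm hr hk hn hk1
  obtain ⟨w, hw, -⟩ := exists_depth_code (m := m) (k := k) (n := n) (Nat.zero_le r) hm
  obtain ⟨x, hx, -⟩ := exists_depth_code (m := m) (r := r) (k := k) (n := n) le_rfl
    (levelCount_pos hm hk hn le_rfl)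
  have hcard : 1 < Fintype.card (LevelwiseVertex m r k n) :=
    Fintype.one_lt_card_iff.mpr ⟨w, x, fun h => by rw [h] at hw; omega⟩
  obtain ⟨a, -, b, -, -, hab, h⟩ := exists_le_sub_of_pairwise (f := f) (L := depth)
    (D := 2 * r + 1) (fun u v huv => by
      have h1 := hf u v huv
      have h2 := dist_le_depth_add_depth hm u v
      rw [hdiam] at h1
      push_cast at h1
      omega) Finset.univ ⟨w, Finset.mem_univ w⟩
  rw [Finset.card_univ] at hab h
  have hends : centerEps (levelwiseGraph m r k n) ≤ depth a + depth b := by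
    by_contra! hlt
    have h1 : m = 1 := by
      by_contra h1
      rw [crossLength, if_neg h1] at heps
      omega
    subst h1
    have ha0 : depth a = 0 := by omega
    refine hab hcard (eq_of_depth_code_modEq (by omega) ?_)
    rw [ha0]
    exact Nat.modEq_one
  have h3 := natAbs_sub_le_labelingSpan f b a
  omega

/-! ### An optimal labeling -/

/-- The number of vertices of depth less than `l`. -/
def levelStart (m : ℕ) (k n : ℕ → ℕ) (l : ℕ) : ℕ := ∑ j ∈ Finset.range l, levelCount m k n j

theorem levelStart_succ (m : ℕ) (k n : ℕ → ℕ) (l : ℕ) :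
    levelStart m k n (l + 1) = levelStart m k n l + levelCount m k n l :=
  Finset.sum_range_succ _ _

theorem levelStart_mono (m : ℕ) (k n : ℕ → ℕ) : Monotone (levelStart m k n) :=
  monotone_nat_of_le_succ fun l => by
    rw [levelStart_succ]
    exact Nat.le_add_right _ _

/-- The depth of the `s`-th vertex in an enumeration by increasing depth that returns to the initial
clique at the end. -/
def seqDepth (m r : ℕ) (k n : ℕ → ℕ) (s : ℕ) : ℕ :=
  if s < levelStart m k n (r + 1) then
    ((Finset.range r).filter fun l => levelStart m k n (l + 1) ≤ s).card
  else 0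

theorem seqDepth_le (m r : ℕ) (k n : ℕ → ℕ) (s : ℕ) : seqDepth m r k n s ≤ r := by
  unfold seqDepth
  split_ifs
  · simpa using Finset.card_filter_le (Finset.range r) fun l => levelStart m k n (l + 1) ≤ s
  · exact Nat.zero_le r

theorem seqDepth_eq {l s : ℕ} (hl : l ≤ r) (h1 : levelStart m k n l ≤ s)
    (h2 : s < levelStart m k n (l + 1)) : seqDepth m r k n s = l := by
  have hmono := levelStart_mono m k n
  rw [seqDepth, if_pos (h2.trans_le (hmono (Nat.succ_le_succ hl)))]
  have : ((Finset.range r).filter fun j => levelStart m k n (j + 1) ≤ s) = Finset.range l := by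
    ext j
    rw [Finset.mem_filter, Finset.mem_range, Finset.mem_range]
    constructor
    · rintro ⟨-, hj⟩
      by_contra! hlj
      have := hmono (Nat.succ_le_succ hlj)
      simp only [Nat.succ_eq_add_one] at this
      omega
    · intro hj
      exact ⟨by omega, (hmono (Nat.succ_le_of_lt hj)).trans h1⟩
  rw [this, Finset.card_range]

theorem sum_seqDepth {l : ℕ} (hl : l ≤ r + 1) :
    ∑ s ∈ Finset.range (levelStart m k n l), seqDepth m r k n s =
      ∑ i ∈ Finset.range l, i * levelCount m k n i := by
  induction l with
  | zero => simp [levelStart]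
  | succ l ih =>
    rw [levelStart_succ, Finset.sum_range_add, ih (by omega), Finset.sum_range_succ]
    congr 1
    rw [Finset.sum_congr rfl (g := fun _ => l)]
    · simp [mul_comm]
    · intro t ht
      rw [Finset.mem_range] at ht
      exact seqDepth_eq (by omega) (by omega) (by rw [levelStart_succ]; omega)

theorem seqDepth_levelStart (m r : ℕ) (k n : ℕ → ℕ) :
    seqDepth m r k n (levelStart m k n (r + 1)) = 0 := by simp [seqDepth]

theorem seqDepth_zero (hm : 1 ≤ m) : seqDepth m r k n 0 = 0 :=
  seqDepth_eq (Nat.zero_le r) (by simp [levelStart]) (by simpa [levelStart, levelCount, Nat.pos_iff_ne_zero] using Nat.one_le_iff_ne_zero.mp hm)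

/-- The positions of one depth form an interval of length `levelCount`, which meets every residue
class. Replacing position 0 by the total number of vertices keeps the depth 0 and the residue, since
every `levelCount` is a multiple of `m`. -/
theorem exists_seq_index (hm : 1 ≤ m) (x : LevelwiseVertex m r k n) :
    ∃ s, 1 ≤ s ∧ s ≤ levelStart m k n (r + 1) ∧ seqDepth m r k n s = depth x ∧
      s ≡ code x [MOD levelCount m k n (depth x)] := by
  have hN : 0 < levelCount m k n (depth x) := (Nat.zero_le _).trans_lt (code_lt x)
  obtain ⟨s, hs1, hs2, hs3⟩ : ∃ s, levelStart m k n (depth x) ≤ s ∧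
      s < levelStart m k n (depth x + 1) ∧ s ≡ code x [MOD levelCount m k n (depth x)] := by
    -- Adding `levelStart * (levelCount - 1)` amounts to subtracting `levelStart` modulo
    -- `levelCount`.
    have hlt := Nat.mod_lt
      (code x + levelStart m k n (depth x) * (levelCount m k n (depth x) - 1)) hN
    refine ⟨_, Nat.le_add_right _ _, by rw [levelStart_succ]; exact Nat.add_lt_add_left hlt _, ?_⟩
    refine ((Nat.mod_modEq _ _).add_left _).trans ?_
    rw [add_left_comm, Nat.mul_sub_one, Nat.add_sub_cancel' (Nat.le_mul_of_pos_right _ hN)]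
    exact Nat.add_mul_mod_self_right _ _ _
  have hsd := seqDepth_eq (depth_le x) hs1 hs2
  have hle := levelStart_mono m k n (Nat.succ_le_succ (depth_le x))
  rcases Nat.eq_zero_or_pos s with rfl | hpos
  · rw [seqDepth_zero hm] at hsd
    have hp : 1 ≤ levelStart m k n (r + 1) := hs2.trans_le hle
    refine ⟨_, hp, le_rfl, (seqDepth_levelStart m r k n).trans hsd, ?_⟩
    refine Nat.ModEq.trans ?_ hs3
    rw [← hsd]
    exact (Nat.modEq_zero_iff_dvd.mpr
      (Finset.dvd_sum fun j _ => levelCount_dvd m k n (Nat.zero_le j)))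
  · exact ⟨s, hpos, (hs2.trans_le hle).le, hsd, hs3⟩

/-- The label of the `s`-th vertex of the enumeration. -/
def seqLabel (m r : ℕ) (k n : ℕ → ℕ) (s : ℕ) : ℕ :=
  ∑ t ∈ Finset.range s, (2 * r + 1 - seqDepth m r k n t - seqDepth m r k n (t + 1))

theorem seqLabel_succ (m r : ℕ) (k n : ℕ → ℕ) (s : ℕ) :
    seqLabel m r k n (s + 1) + seqDepth m r k n s + seqDepth m r k n (s + 1) =
      seqLabel m r k n s + (2 * r + 1) := by
  have h1 := seqDepth_le m r k n s
  have h2 := seqDepth_le m r k n (s + 1)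
  rw [seqLabel, Finset.sum_range_succ, ← seqLabel]
  omega

theorem seqLabel_mono (m r : ℕ) (k n : ℕ → ℕ) : Monotone (seqLabel m r k n) :=
  monotone_nat_of_le_succ fun s => by
    have h1 := seqDepth_le m r k n s
    have h2 := seqDepth_le m r k n (s + 1)
    have := seqLabel_succ m r k n s
    omega

/-- Each intermediate vertex of depth `l` contributes `2 * (r - l) + 1 ≥ 1`. -/
theorem seqLabel_add (m r : ℕ) (k n : ℕ → ℕ) (s e : ℕ) :
    seqLabel m r k n s + (2 * r + 1) + e ≤
      seqLabel m r k n (s + 1 + e) + seqDepth m r k n s + seqDepth m r k n (s + 1 + e) := by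
  induction e with
  | zero => exact (seqLabel_succ m r k n s).ge
  | succ e ih =>
    have h1 := seqDepth_le m r k n (s + 1 + e)
    have h2 := seqLabel_succ m r k n (s + 1 + e)
    rw [← add_assoc (s + 1) e 1]
    omega

theorem seqLabel_add_sum (m r : ℕ) (k n : ℕ → ℕ) (s : ℕ) :
    seqLabel m r k n s + 2 * ∑ t ∈ Finset.range s, seqDepth m r k n t + seqDepth m r k n s =
      s * (2 * r + 1) + seqDepth m r k n 0 := by
  induction s with
  | zero => simp [seqLabel]
  | succ s ih =>
    have := seqLabel_succ m r k n s
    rw [Finset.sum_range_succ, add_mul s, one_mul]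
    omega

theorem two_mul_levelCount_le (hk : ∀ i ∈ Finset.Icc 1 r, 1 ≤ k i)
    (hn : ∀ i ∈ Finset.Icc 1 r, 2 ≤ n i) {i : ℕ} (hi : i < r) :
    2 * levelCount m k n i ≤ levelCount m k n (i + 1) := by
  have hmem : i + 1 ∈ Finset.Icc 1 r := Finset.mem_Icc.mpr ⟨by omega, hi⟩
  rw [levelCount, mul_comm]
  exact Nat.mul_le_mul_left _ (Nat.mul_le_mul (hk _ hmem) (hn _ hmem))

/-- Doubling outgrows the linear bound needed to absorb the shortfall at a common ancestor of depth
`i`. For `m = 1` one unit less is needed, but that bound only starts at depth 1. -/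
theorem le_levelCount (hm : 3 ≤ m) (hk : ∀ i ∈ Finset.Icc 1 r, 1 ≤ k i)
    (hn : ∀ i ∈ Finset.Icc 1 r, 2 ≤ n i) {i : ℕ} (hi : i ≤ r) :
    2 * i + 3 ≤ levelCount m k n i := by
  induction i with
  | zero => exact hm
  | succ i ih =>
    have := two_mul_levelCount_le (m := m) hk hn (i := i) (by omega)
    have := ih (by omega)
    omega

theorem le_levelCount_one (hk1 : 2 ≤ k 1) (hk : ∀ i ∈ Finset.Icc 1 r, 1 ≤ k i)
    (hn : ∀ i ∈ Finset.Icc 1 r, 2 ≤ n i) {i : ℕ} (hi1 : 1 ≤ i) (hi : i ≤ r) :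
    2 * i + 2 ≤ levelCount 1 k n i := by
  induction i, hi1 using Nat.le_induction with
  | base =>
    have := Nat.mul_le_mul hk1 (hn 1 (Finset.mem_Icc.mpr ⟨le_rfl, hi⟩))
    change 4 ≤ 1 * (k 1 * n 1)
    omega
  | succ i hi1 ih =>
    have := two_mul_levelCount_le (m := 1) hk hn (i := i) (by omega)
    have := ih (by omega)
    omega

/-- Vertices whose residues agree with positions at distance `e + 1` are far apart. -/
theorem depth_add_depth_le_dist_add (hm : 1 ≤ m) (hm2 : m ≠ 2)
    (hk : ∀ i ∈ Finset.Icc 1 r, 1 ≤ k i) (hn : ∀ i ∈ Finset.Icc 1 r, 2 ≤ n i)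
    (hk1 : m = 1 → 2 ≤ k 1) {x y : LevelwiseVertex m r k n} (hne : x ≠ y) {s e : ℕ}
    (hx : s ≡ code x [MOD levelCount m k n (depth x)])
    (hy : s + 1 + e ≡ code y [MOD levelCount m k n (depth y)]) :
    depth x + depth y + crossLength m ≤ (levelwiseGraph m r k n).dist x y + e := by
  -- A common ancestor of depth `h` makes the two positions congruent modulo `levelCount m k n h`,
  -- so this number divides `e + 1`.
  have hdvd : ∀ {h}, h ≤ depth x → h ≤ depth y → code x ≡ code y [MOD levelCount m k n h] →
      levelCount m k n h ≤ e + 1 := by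
    intro h h1 h2 h3
    have h4 := ((hx.of_dvd (levelCount_dvd m k n h1)).trans h3).trans
      (hy.of_dvd (levelCount_dvd m k n h2)).symm
    have h5 := (Nat.modEq_iff_dvd' (by omega)).mp h4
    exact Nat.le_of_dvd (by omega) (by rwa [show s + 1 + e - s = e + 1 by omega] at h5)
  by_cases h1 : m = 1
  · subst h1
    have hk2 := hk1 rfl
    rw [crossLength, if_pos rfl, add_zero]
    obtain ⟨h, hhx, hhy, hc, hd⟩ := exists_common_ancestor hm hne Nat.modEq_one
    rcases Nat.eq_zero_or_pos h with rfl | hpos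
    · rcases Nat.eq_zero_or_pos e with rfl | he
      -- Consecutive positions differ modulo `k 1 ≥ 2`, hence belong to different branches at the
      -- root.
      · have hmod : depth x ≠ 0 → depth y ≠ 0 → ¬ code y ≡ code x [MOD k 1] := by
          intro hx0 hy0 hcon
          have hd : ∀ {i}, i ≠ 0 → k 1 ∣ levelCount 1 k n i := fun {i} hi => by
            have := levelCount_mul_dvd 1 k n (Nat.pos_of_ne_zero hi)
            rwa [levelCount, one_mul] at this
          have h4 := ((hx.of_dvd (hd hx0)).trans hcon.symm).trans (hy.of_dvd (hd hy0)).symm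
          have h5 := (Nat.modEq_iff_dvd' (by omega)).mp h4
          rw [show s + 1 + 0 - s = 1 by omega] at h5
          have := Nat.le_of_dvd one_pos h5
          omega
        by_cases hx0 : depth x = 0
        · by_cases hy0 : depth y = 0
          · omega
          · have := depth_add_depth_le_dist (x := y) (y := x) hy0 (Or.inl hx0)
            rw [SimpleGraph.dist_comm]
            omega
        · have := depth_add_depth_le_dist (x := x) (y := y) hx0 (by
            by_cases hy0 : depth y = 0
            · exact Or.inl hy0
            · exact Or.inr (hmod hx0 hy0))
          omega
      · omega
    · have h2 := hdvd hhx hhy hc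
      have h3 := le_levelCount_one (n := n) hk2 hk hn hpos (hhx.trans (depth_le x))
      omega
  · rw [crossLength, if_neg h1]
    by_cases h0 : code x ≡ code y [MOD m]
    · obtain ⟨h, hhx, hhy, hc, hd⟩ := exists_common_ancestor hm hne h0
      have h2 := hdvd hhx hhy hc
      have h3 := le_levelCount (m := m) (by omega) hk hn (hhx.trans (depth_le x))
      omega
    · have := depth_add_depth_add_one_le_dist hm (x := x) (y := y) fun h => h0 h.symm
      omega

/-- Position 1 begins the enumeration and its end has depth 0, so the end depths attain the minimum
ε of the lower bound. -/
theorem seqDepth_one (hm : 1 ≤ m) (hm2 : m ≠ 2) (hr : 1 ≤ r)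
    (hk : ∀ i ∈ Finset.Icc 1 r, 1 ≤ k i) (hn : ∀ i ∈ Finset.Icc 1 r, 2 ≤ n i)
    (hk1 : m = 1 → 2 ≤ k 1) :
    seqDepth m r k n 1 = centerEps (levelwiseGraph m r k n) := by
  have heps := centerEps_add_crossLength (r := r) (n := n) hm hm2 hk1
  have hstart : levelStart m k n 1 = m := by simp [levelStart, levelCount]
  rw [crossLength] at heps
  split_ifs at heps with h1
  · rw [add_zero] at heps
    rw [heps]
    have := levelCount_pos hm hk hn hr
    refine seqDepth_eq hr (by omega) ?_
    rw [levelStart_succ]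
    omega
  · rw [seqDepth_eq (Nat.zero_le r) (by simp [levelStart]) (by rw [zero_add]; omega)]
    omega

theorem exists_radioLabeling (hm : 1 ≤ m) (hm2 : m ≠ 2) (hr : 1 ≤ r)
    (hk : ∀ i ∈ Finset.Icc 1 r, 1 ≤ k i) (hn : ∀ i ∈ Finset.Icc 1 r, 2 ≤ n i)
    (hk1 : m = 1 → 2 ≤ k 1) :
    ∃ f : LevelwiseVertex m r k n → ℕ, IsRadioLabeling (levelwiseGraph m r k n) f ∧
      ∀ u v, ((((f u : ℤ) - f v).natAbs : ℕ) : ℤ) ≤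
        ((Fintype.card (LevelwiseVertex m r k n) : ℤ) - 1) * (2 * r + 1)
          - 2 * ∑ v : LevelwiseVertex m r k n, (depth v : ℤ)
          + centerEps (levelwiseGraph m r k n) := by
  choose σ hσ1 hσ2 hσd hσc using exists_seq_index (m := m) (r := r) (k := k) (n := n) hm
  refine ⟨fun v => seqLabel m r k n (σ v), ?_, ?_⟩
  · have key : ∀ u v, σ u < σ v → ((levelwiseGraph m r k n).diam : ℤ) + 1 -
        (levelwiseGraph m r k n).dist u v ≤
          |(seqLabel m r k n (σ u) : ℤ) - seqLabel m r k n (σ v)| := by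
      intro u v huv
      obtain ⟨e, he⟩ := Nat.exists_eq_add_of_le (Nat.succ_le_of_lt huv)
      rw [Nat.succ_eq_add_one] at he
      have h1 := depth_add_depth_le_dist_add hm hm2 hk hn hk1 (x := u) (y := v)
        (fun h => by rw [h] at huv; omega) (hσc u) (he ▸ hσc v)
      have h2 := seqLabel_add m r k n (σ u) e
      rw [← he, hσd, hσd] at h2
      rw [diam_levelwiseGraph hm hr hk hn hk1, abs_sub_comm]
      refine le_trans ?_ (le_abs_self _)
      push_cast
      omega
    intro u v hne
    rcases lt_trichotomy (σ u) (σ v) with h | h | h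
    · exact key u v h
    · have hd : depth u = depth v := by rw [← hσd, ← hσd, h]
      refine absurd (eq_of_depth_code_modEq hd ((hσc u).symm.trans ?_)) hne
      rw [h, hd]
      exact hσc v
    · rw [SimpleGraph.dist_comm, abs_sub_comm]
      exact key v u h
  · intro u v
    -- The used positions run from 1 to the order of the graph. By `h6` the label at position 1 is
    -- `2 * r + 1` minus ε; its subtraction from the last label, given by `h5`, yields the span.
    have hmono := seqLabel_mono m r k n
    have h1 := hmono (hσ1 u)
    have h2 := hmono (hσ1 v)
    have h3 := hmono (hσ2 u)
    have h4 := hmono (hσ2 v)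
    have h5 := seqLabel_add_sum m r k n (levelStart m k n (r + 1))
    have h6 := seqLabel_add_sum m r k n 1
    have h7 : ∑ v : LevelwiseVertex m r k n, depth v =
        ∑ i ∈ Finset.range (r + 1), i * levelCount m k n i := sum_depth m r k n fun i => i
    have h8 : Fintype.card (LevelwiseVertex m r k n) = levelStart m k n (r + 1) :=
      card_levelwiseVertex m r k n
    rw [sum_seqDepth le_rfl, ← h7, seqDepth_levelStart, seqDepth_zero hm, ← h8] at h5
    rw [Finset.sum_range_one, seqDepth_zero hm, seqDepth_one hm hm2 hr hk hn hk1] at h6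
    rw [← h8] at h3 h4
    zify at h5
    rw [sub_mul]
    beta_reduce
    omega

end

/-! ### The radio number and its closed form -/

section
variable {m r : ℕ} {k n : ℕ → ℕ}

theorem radioNumber_levelwiseGraph (hm : 1 ≤ m) (hm2 : m ≠ 2) (hr : 1 ≤ r)
    (hk : ∀ i ∈ Finset.Icc 1 r, 1 ≤ k i) (hn : ∀ i ∈ Finset.Icc 1 r, 2 ≤ n i)
    (hk1 : m = 1 → 2 ≤ k 1) :
    (radioNumber (levelwiseGraph m r k n) : ℤ) =
      ((Fintype.card (LevelwiseVertex m r k n) : ℤ) - 1) * (2 * r + 1)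
        - 2 * ∑ v : LevelwiseVertex m r k n, (depth v : ℤ)
        + centerEps (levelwiseGraph m r k n) := by
  obtain ⟨f, hf, hs⟩ := exists_radioLabeling hm hm2 hr hk hn hk1
  refine le_antisymm ?_ ?_
  · obtain ⟨w, -, -⟩ := exists_depth_eq_zero r k n hm
    obtain ⟨s, hs'⟩ := Int.eq_ofNat_of_zero_le ((Int.natCast_nonneg _).trans (hs w w))
    rw [hs'] at hs ⊢
    exact_mod_cast radioNumber_le hf fun u v => by exact_mod_cast hs u v
  · obtain ⟨g, hg, hgs⟩ := Nat.sInf_mem (s := {t : ℕ | ∃ f : LevelwiseVertex m r k n → ℕ,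
      IsRadioLabeling (levelwiseGraph m r k n) f ∧ labelingSpan f = t}) ⟨_, f, hf, rfl⟩
    rw [radioNumber, ← hgs]
    exact le_labelingSpan hm hm2 hr hk hn hk1 hg

theorem sum_range_succ_levelCount (m r : ℕ) (k n : ℕ → ℕ) (g : ℕ → ℤ) :
    ∑ i ∈ Finset.range (r + 1), g i * (levelCount m k n i : ℤ) = g 0 * m +
      m * ∑ i ∈ Finset.Icc 1 r, g i * ∏ j ∈ Finset.Icc 1 i, (k j : ℤ) * (n j : ℤ) := by
  rw [Finset.range_eq_Ico, Finset.sum_eq_sum_Ico_succ_bot (Nat.succ_pos r), Finset.mul_sum]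
  congr 1
  refine Finset.sum_congr (by ext; simp) fun i _ => ?_
  rw [levelCount_eq_prod]
  push_cast
  ring

theorem card_levelwiseVertex_eq (m r : ℕ) (k n : ℕ → ℕ) :
    (Fintype.card (LevelwiseVertex m r k n) : ℤ) = m +
      m * ∑ i ∈ Finset.Icc 1 r, ∏ j ∈ Finset.Icc 1 i, (k j : ℤ) * (n j : ℤ) := by
  rw [card_levelwiseVertex]
  simpa using sum_range_succ_levelCount m r k n fun _ => 1

theorem sum_depth_eq (m r : ℕ) (k n : ℕ → ℕ) :
    ∑ v : LevelwiseVertex m r k n, (depth v : ℤ) =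
      m * ∑ i ∈ Finset.Icc 1 r, (i : ℤ) * ∏ j ∈ Finset.Icc 1 i, (k j : ℤ) * (n j : ℤ) := by
  have h := sum_depth m r k n fun i => i
  rw [← Nat.cast_sum, h]
  simpa using sum_range_succ_levelCount m r k n fun i => i

end

theorem theorem5 (m r : ℕ) (k n : ℕ → ℕ) (hm : 1 ≤ m) (hm2 : m ≠ 2) (hr : 1 ≤ r)
    (hk : ∀ i ∈ Finset.Icc 1 r, 1 ≤ k i) (hn : ∀ i ∈ Finset.Icc 1 r, 2 ≤ n i)
    (hk1 : m = 1 → 2 ≤ k 1) :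
    IsLowerBoundBlockGraph (levelwiseGraph m r k n) ∧
    (radioNumber (levelwiseGraph m r k n) : ℤ) =
      (((m : ℤ) - 1) + (m : ℤ) * ∑ i ∈ Finset.Icc 1 r, ∏ j ∈ Finset.Icc 1 i, (k j : ℤ) * (n j : ℤ))
          * (2 * (r : ℤ) + 1)
        - 2 * (m : ℤ) *
            ∑ i ∈ Finset.Icc 1 r, (i : ℤ) * ∏ j ∈ Finset.Icc 1 i, (k j : ℤ) * (n j : ℤ)
        + (centerEps (levelwiseGraph m r k n) : ℤ) := by
  have hdiam := diam_levelwiseGraph hm hr hk hn hk1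
  have hrn := radioNumber_levelwiseGraph hm hm2 hr hk hn hk1
  refine ⟨⟨levelwiseGraph_isBlockGraph hm, by omega, ?_⟩, ?_⟩
  · have heps : (centerEps (levelwiseGraph m r k n) : ℤ) = 1 - crossLength m := by
      have := centerEps_add_crossLength (r := r) (n := n) hm hm2 hk1
      omega
    rw [hrn, radioLowerBound, hdiam, totalLevel_levelwiseGraph hm hm2 hk1, heps]
    push_cast
    ring
  · rw [hrn, card_levelwiseVertex_eq, sum_depth_eq]
    ring
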